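/- An anti-lecture hall composition of $n$ is a sequence $\lambda=(\lambda_1,\lambda_2,\lambda_3,\ldots)$ of nonnegative integers, only finitely many of them nonzero, with $\sum_{i\ge1}\lambda_i=n$ and $$\frac{\lambda_1}{1}\ge\frac{\lambda_2}{2}\ge\frac{\lambda_3}{3}\ge\cdots\ge 0 .$$ For $b,n\ge 0$ let $F_b(n)$ be the set of anti-lecture hall compositions $\lambda$ of $n$ with $\lambda_1\le b$. Let $(a;q)_n=\prod_{j=0}^{n-1}(1-aq^j)$. Theorem. Let $k\ge2$ be an integer. Then $F_{2k-3}(n)$ is finite for every $n\ge0$, and in the ring $\mathbb Z[[q]]$ of formal power series $$\sum_{n=0}^{\infty}|F_{2k-3}(n)|\,q^n=\sum_{N_1\ge N_2\ge\cdots\ge N_{k-1}\ge0}\frac{q^{N_1(N_1+1)/2+N_2^2+\cdots+N_{k-1}^2+N_2+\cdots+N_{k-1}}\,(-q;q)_{N_1}}{(q;q)_{N_1-N_2}\cdots(q;q)_{N_{k-2}-N_{k-1}}\,(q;q)_{N_{k-1}}\,(-q;q)_{N_{k-1}}},$$ where the sum on the right is over all integer $(k-1)$-tuples $(N_1,\ldots,N_{k-1})$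 with the indicated inequalities and converges coefficientwise. -/

import Mathlib

open scoped PowerSeries.WithPiTopology

namespace AntiLectureHall

/-- An anti-lecture hall composition, written as an infinite vector ending with zeros
(so trailing zeros are not recorded): a finitely supported sequence of nonnegative integers
`(lam_1, lam_2, ...)` with `lam_1 / 1 ≥ lam_2 / 2 ≥ lam_3 / 3 ≥ ... ≥ 0`.
The entry `lam_(i+1)` is stored at index `i`. -/
def IsAntiLectureHall (lam : ℕ →₀ ℕ) : Prop :=
  ∀ i : ℕ, (lam (i + 1) : ℚ) / ((i : ℚ) + 2) ≤ (lam i : ℚ) / ((i : ℚ) + 1)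

/-- `F b n`: the set of anti-lecture hall compositions of `n` (sum of all entries equal to `n`)
with first entry at most `b`. -/
def F (b n : ℕ) : Set (ℕ →₀ ℕ) :=
  {lam | IsAntiLectureHall lam ∧ (lam.sum fun _ a => a) = n ∧ lam 0 ≤ b}

/-- The indeterminate `q` of the ring `ℤ⟦q⟧` of formal power series. -/
noncomputable def q : PowerSeries ℤ := PowerSeries.X

/-- The q-shifted factorial `(a; q)_n = (1 - a) (1 - a q) ⋯ (1 - a q^(n-1))`. -/
noncomputable def qPoch (a : PowerSeries ℤ) (n : ℕ) : PowerSeries ℤ :=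
  ∏ j ∈ Finset.range n, (1 - a * q ^ j)

/-- `entry N i` is the i-th entry `N_i` (counted from 1) of the tuple `N = (N_1, ..., N_m)`.
It is only used for `1 ≤ i ≤ m`. -/
def entry {m : ℕ} (N : Fin m → ℕ) (i : ℕ) : ℕ :=
  if h : 1 ≤ i ∧ i ≤ m then N ⟨i - 1, by omega⟩ else 0

/-- The exponent `N_1 (N_1 + 1) / 2 + N_2^2 + ... + N_{k-1}^2 + N_2 + ... + N_{k-1}`. -/
def expo (k : ℕ) (N : Fin (k - 1) → ℕ) : ℕ :=
  entry N 1 * (entry N 1 + 1) / 2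
    + ∑ i ∈ Finset.Icc 2 (k - 1), entry N i ^ 2
    + ∑ i ∈ Finset.Icc 2 (k - 1), entry N i

/-- The denominator
`(q;q)_{N_1-N_2} ⋯ (q;q)_{N_{k-2}-N_{k-1}} (q;q)_{N_{k-1}} (-q;q)_{N_{k-1}}`. -/
noncomputable def denom (k : ℕ) (N : Fin (k - 1) → ℕ) : PowerSeries ℤ :=
  (∏ i ∈ Finset.Icc 1 (k - 2), qPoch q (entry N i - entry N (i + 1)))
    * qPoch q (entry N (k - 1)) * qPoch (-q) (entry N (k - 1))

/-- The summand `q^expo (-q;q)_{N_1} / denom`. The denominator has constant coefficient `1`, and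
`PowerSeries.invOfUnit _ 1` is its multiplicative inverse (see `denom_mul_inv`). -/
noncomputable def summand (k : ℕ) (N : Fin (k - 1) → ℕ) : PowerSeries ℤ :=
  q ^ expo k N * qPoch (-q) (entry N 1) * PowerSeries.invOfUnit (denom k N) 1

theorem constantCoeff_qPoch (a : PowerSeries ℤ) (ha : PowerSeries.constantCoeff a = 0) (n : ℕ) :
    PowerSeries.constantCoeff (qPoch a n) = 1 := by
  simp [qPoch, map_prod, ha]

theorem denom_mul_inv (k : ℕ) (N : Fin (k - 1) → ℕ) :
    denom k N * PowerSeries.invOfUnit (denom k N) 1 = 1 := by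
  apply PowerSeries.mul_invOfUnit
  have h1 : PowerSeries.constantCoeff q = 0 := by simp [q]
  have h2 : PowerSeries.constantCoeff (-q) = 0 := by simp [q]
  simp [denom, map_prod, constantCoeff_qPoch _ h1, constantCoeff_qPoch _ h2]

end AntiLectureHall

/-! Raise the bound on the first entry by one at a time, among compositions of length at most `M`.
Let `m` be the number of leading entries with `lam_i ≥ i`. Subtracting `1, ..., m` from those
entries leaves a composition of length `m` with bound `b` instead of `b + 1`; the remaining entries
form a partition in an `m × (M - m)` box (`truncGF_succ`). Boxes are counted by Gaussian binomials
(`boxGF_mul`), so division by `(q;q)_M` turns this into a Bailey-type chain with weight `q ^ tri m /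
(q;q)_(M-m)` (`normGF_succ`).

The `q`-binomial theorem merges two such steps into one of weight `q ^ (r² + r)`, once both ends are
divided by `(-q;q)` factors (`two_step`). The bound `2k - 3` is odd: `k - 2` merged steps produce
`N_2, ..., N_(k-1)`, and one unpaired step, with `M → ∞`, produces `N_1` with weight `q ^ tri N_1`.
Undoing the normalisation at `N_1` gives the factor `(-q;q)_(N_1)`. -/

namespace AntiLectureHall

/-! ### Inverse `q`-factorials and the `q`-binomial theorem -/

/-- The triangular number `m (m + 1) / 2`. -/
def tri (m : ℕ) : ℕ := m * (m + 1) / 2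

theorem tri_mul_two (m : ℕ) : tri m * 2 = m * (m + 1) :=
  Nat.div_mul_cancel (Nat.even_mul_succ_self m).two_dvd

theorem tri_add (r s : ℕ) : tri (r + s) = tri r + r * s + tri s := by
  have h1 := tri_mul_two (r + s)
  have h2 := tri_mul_two r
  have h3 := tri_mul_two s
  nlinarith

theorem le_tri (m : ℕ) : m ≤ tri m := by
  have := tri_mul_two m
  nlinarith [Nat.zero_le m, Nat.le_mul_self m]

theorem sum_range_succ_eq_tri (m : ℕ) : ∑ i ∈ Finset.range m, (i + 1) = tri m := by
  induction m with
  | zero => rfl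
  | succ m ih => rw [Finset.sum_range_succ, ih, tri_add m 1]; simp [tri]; ring

theorem constantCoeff_q : PowerSeries.constantCoeff q = 0 := by simp [q]

theorem constantCoeff_neg_q : PowerSeries.constantCoeff (-q) = 0 := by simp [q]

/-- `1 / (q; q)_n`. -/
noncomputable def qInv (n : ℕ) : PowerSeries ℤ := PowerSeries.invOfUnit (qPoch q n) 1

/-- `1 / (-q; q)_n`. -/
noncomputable def negInv (n : ℕ) : PowerSeries ℤ := PowerSeries.invOfUnit (qPoch (-q) n) 1

theorem qPoch_mul_qInv (n : ℕ) : qPoch q n * qInv n = 1 :=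
  PowerSeries.mul_invOfUnit _ _ (by simp [constantCoeff_qPoch _ constantCoeff_q])

theorem qPoch_mul_negInv (n : ℕ) : qPoch (-q) n * negInv n = 1 :=
  PowerSeries.mul_invOfUnit _ _ (by simp [constantCoeff_qPoch _ constantCoeff_neg_q])

theorem qPoch_succ (a : PowerSeries ℤ) (n : ℕ) :
    qPoch a (n + 1) = qPoch a n * (1 - a * q ^ n) :=
  Finset.prod_range_succ _ _

theorem qInv_zero : qInv 0 = 1 := by
  have := qPoch_mul_qInv 0
  simpa [qPoch] using this

theorem qInv_succ (n : ℕ) : (1 - q ^ (n + 1)) * qInv (n + 1) = qInv n := by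
  have h := qPoch_mul_qInv (n + 1)
  rw [qPoch_succ, ← pow_succ'] at h
  linear_combination qInv n * h - (1 - q ^ (n + 1)) * qInv (n + 1) * qPoch_mul_qInv n

theorem qPoch_neg_add (r t : ℕ) :
    qPoch (-q) (r + t) = qPoch (-q) r * ∏ j ∈ Finset.range t, (1 + q ^ (r + 1) * q ^ j) := by
  rw [qPoch, Finset.prod_range_add, ← qPoch]
  congr 1
  exact Finset.prod_congr rfl fun j _ => by ring

/-- The finite `q`-binomial theorem. -/
theorem sum_qInv_mul_qInv (z : PowerSeries ℤ) (t : ℕ) :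
    ∑ s ∈ Finset.range (t + 1), q ^ tri s * z ^ s * (qInv s * qInv (t - s)) =
      qInv t * ∏ j ∈ Finset.range t, (1 + z * q * q ^ j) := by
  induction t with
  | zero => simp [tri, qInv_zero]
  | succ t ih =>
    have key : (1 - q ^ (t + 1)) *
        ∑ s ∈ Finset.range (t + 1 + 1), q ^ tri s * z ^ s * (qInv s * qInv (t + 1 - s)) =
        (1 + z * q * q ^ t) *
          ∑ s ∈ Finset.range (t + 1), q ^ tri s * z ^ s * (qInv s * qInv (t - s)) := by
      -- Uses `1 - q^(t+1) = (1 - q^(t+1-s)) + q^(t+1-s) (1 - q^s)`: each summand lowers the index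
      -- of one of the two inverses.
      have split : ∀ s ∈ Finset.range (t + 1 + 1),
          (1 - q ^ (t + 1)) * (q ^ tri s * z ^ s * (qInv s * qInv (t + 1 - s))) =
          q ^ tri s * z ^ s * (qInv s * ((1 - q ^ (t + 1 - s)) * qInv (t + 1 - s))) +
          q ^ (t + 1 - s) * q ^ tri s * z ^ s * ((1 - q ^ s) * qInv s * qInv (t + 1 - s)) := by
        intro s hs
        have : q ^ (t + 1) = q ^ (t + 1 - s) * q ^ s := by
          rw [← pow_add]; congr 1; have := Finset.mem_range.1 hs; omega
        rw [this]; ring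
      rw [Finset.mul_sum, Finset.sum_congr rfl split, Finset.sum_add_distrib,
        Finset.sum_range_succ, Finset.sum_range_succ' _ (t + 1), add_mul, one_mul]
      simp only [Nat.sub_self, pow_zero, sub_self, zero_mul, mul_zero, add_zero]
      congr 1
      · refine Finset.sum_congr rfl fun s hs => ?_
        have hst : t + 1 - s = t - s + 1 := by have := Finset.mem_range.1 hs; omega
        rw [hst, qInv_succ]
      · rw [Finset.mul_sum]
        refine Finset.sum_congr rfl fun s hs => ?_
        have hst : t = t - s + s := by have := Finset.mem_range.1 hs; omega
        have e : q ^ t = q ^ (t - s) * q ^ s := by rw [← pow_add, ← hst]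
        rw [qInv_succ, e, tri_add s 1, Nat.add_sub_add_right]
        simp only [tri]
        ring
    rw [ih] at key
    have h := qInv_succ t
    have hu := qPoch_mul_qInv (t + 1)
    rw [qPoch_succ, ← pow_succ'] at hu
    rw [Finset.prod_range_succ]
    generalize ∑ s ∈ Finset.range (t + 1 + 1),
      q ^ tri s * z ^ s * (qInv s * qInv (t + 1 - s)) = S at *
    generalize ∏ j ∈ Finset.range t, (1 + z * q * q ^ j) = P at *
    linear_combination qPoch q t * qInv (t + 1) * key - S * hu +
      qInv (t + 1) * (1 + z * q * q ^ t) * P * qPoch_mul_qInv t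

/-- The `q`-binomial theorem at `z = q ^ r`, since `tri (r + s) = tri r + r s + tri s`; its product
is `(-q;q)_(r+t) / (-q;q)_r`. -/
theorem sum_tri_qInv (r t : ℕ) :
    qPoch (-q) r *
        ∑ s ∈ Finset.range (t + 1), q ^ tri (r + s) * (qInv (t - s) * qInv s) =
      q ^ tri r * qInv t * qPoch (-q) (r + t) := by
  have h := sum_qInv_mul_qInv (q ^ r) t
  rw [qPoch_neg_add]
  simp only [← pow_succ] at h
  have : ∑ s ∈ Finset.range (t + 1), q ^ tri (r + s) * (qInv (t - s) * qInv s) =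
      q ^ tri r * ∑ s ∈ Finset.range (t + 1), q ^ tri s * (q ^ r) ^ s * (qInv s * qInv (t - s)) := by
    rw [Finset.mul_sum]
    refine Finset.sum_congr rfl fun s _ => ?_
    rw [tri_add, pow_add, pow_add, pow_mul]; ring
  rw [this, h]; ring

/-- Two steps of the chain with weight `q ^ tri m` amount to one step with weight `q ^ (r² + r)`. -/
theorem two_step (B C D : ℕ → PowerSeries ℤ)
    (hC : ∀ M, C M = ∑ m ∈ Finset.range (M + 1), q ^ tri m * qInv (M - m) * B m)
    (hD : ∀ M, D M = ∑ m ∈ Finset.range (M + 1), q ^ tri m * qInv (M - m) * C m) (M : ℕ) :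
    negInv M * D M =
      ∑ r ∈ Finset.range (M + 1), q ^ (r ^ 2 + r) * qInv (M - r) * (negInv r * B r) := by
  have swap : D M = ∑ r ∈ Finset.range (M + 1), ∑ s ∈ Finset.range (M - r + 1),
      q ^ tri (r + s) * qInv (M - (r + s)) * (q ^ tri r * qInv s * B r) := by
    rw [hD]
    simp only [hC, Finset.mul_sum, Finset.sum_sigma']
    refine Finset.sum_nbij' (fun x => ⟨x.2, x.1 - x.2⟩) (fun x => ⟨x.1 + x.2, x.1⟩) ?_ ?_ ?_ ?_ ?_
    · rintro ⟨m, r⟩ h; simp at h ⊢; omega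
    · rintro ⟨r, s⟩ h; simp at h ⊢; omega
    · rintro ⟨m, r⟩ h; simp at h ⊢; omega
    · rintro ⟨r, s⟩ h; simp
    · rintro ⟨m, r⟩ h
      simp only [Finset.mem_sigma, Finset.mem_range] at h
      have : r + (m - r) = m := by omega
      simp only [this]
  rw [swap, Finset.mul_sum]
  refine Finset.sum_congr rfl fun r hr => ?_
  have hM : r + (M - r) = M := by have := Finset.mem_range.1 hr; omega
  have h := sum_tri_qInv r (M - r)
  rw [hM] at h
  have : ∑ s ∈ Finset.range (M - r + 1),
      q ^ tri (r + s) * qInv (M - (r + s)) * (q ^ tri r * qInv s * B r) =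
      q ^ tri r * B r * ∑ s ∈ Finset.range (M - r + 1),
        q ^ tri (r + s) * (qInv (M - r - s) * qInv s) := by
    rw [Finset.mul_sum]
    refine Finset.sum_congr rfl fun s _ => ?_
    rw [Nat.sub_add_eq]; ring
  rw [this]
  -- One factor `q ^ tri r` is the inner weight, the other comes out of `sum_tri_qInv`.
  have e : q ^ (r ^ 2 + r) = q ^ tri r * q ^ tri r := by
    rw [← pow_add]; congr 1; have := tri_mul_two r; nlinarith
  rw [e]
  generalize ∑ s ∈ Finset.range (M - r + 1), q ^ tri (r + s) * (qInv (M - r - s) * qInv s) = S at *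
  linear_combination negInv r * q ^ tri r * B r * negInv M * h +
    (q ^ tri r) ^ 2 * qInv (M - r) * negInv r * B r * qPoch_mul_negInv M -
    q ^ tri r * B r * negInv M * S * qPoch_mul_negInv r

/-! ### Partitions in a box and compositions of bounded length -/

/-- Partitions with at most `t` parts, each at most `c`, as antitone sequences. -/
def box (c t : ℕ) : Set (ℕ → ℕ) :=
  {rho | Antitone rho ∧ rho 0 ≤ c ∧ ∀ i, t ≤ i → rho i = 0}

/-- Anti-lecture hall compositions of length `M` with first entry at most `b`. -/
def truncated (b M : ℕ) : Set (ℕ → ℕ) :=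
  {lam | (∀ i, lam (i + 1) * (i + 1) ≤ lam i * (i + 2)) ∧ lam 0 ≤ b ∧ ∀ i, M ≤ i → lam i = 0}

theorem finite_of_bounded {S : Set (ℕ → ℕ)} (B : ℕ → ℕ) (M : ℕ)
    (hB : ∀ f ∈ S, ∀ i, f i ≤ B i) (hM : ∀ f ∈ S, ∀ i, M ≤ i → f i = 0) : S.Finite := by
  refine Set.Finite.of_injOn (f := fun f (i : Fin M) => f i)
    (t := Set.Iic fun i : Fin M => B i) (fun f hf i => hB f hf i) ?_ (Set.finite_Iic _)
  intro f hf g hg h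
  funext i
  by_cases hi : i < M
  · exact congrFun h ⟨i, hi⟩
  · rw [hM f hf i (by omega), hM g hg i (by omega)]

theorem box_finite (c t : ℕ) : (box c t).Finite :=
  finite_of_bounded (fun _ => c) t (fun _ hf i => (hf.1 (Nat.zero_le i)).trans hf.2.1)
    fun _ hf => hf.2.2

theorem truncated_finite (b M : ℕ) : (truncated b M).Finite := by
  -- The ratios `lam_i / i` decrease from `lam_1 ≤ b`.
  refine finite_of_bounded (fun i => b * (i + 1)) M (fun f hf i => ?_) fun _ hf => hf.2.2
  induction i with
  | zero => simpa using hf.2.1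
  | succ i ih =>
    have h := hf.1 i
    have : f (i + 1) * (i + 1) ≤ (b * (i + 1 + 1)) * (i + 1) := by nlinarith
    exact Nat.le_of_mul_le_mul_right this (Nat.succ_pos i)

/-- The generating polynomial of `box c t`. -/
noncomputable def boxGF (c t : ℕ) : PowerSeries ℤ :=
  ∑ rho ∈ (box_finite c t).toFinset, q ^ ∑ i ∈ Finset.range t, rho i

/-- The generating polynomial of `truncated b M`. -/
noncomputable def truncGF (b M : ℕ) : PowerSeries ℤ :=
  ∑ lam ∈ (truncated_finite b M).toFinset, q ^ ∑ i ∈ Finset.range M, lam i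

theorem boxGF_eq_one_of_forall {c t : ℕ} (h : ∀ rho ∈ box c t, rho = 0) : boxGF c t = 1 := by
  have : (box_finite c t).toFinset = {0} := by
    ext rho
    simp only [Set.Finite.mem_toFinset, Finset.mem_singleton]
    refine ⟨h rho, ?_⟩
    rintro rfl
    exact ⟨fun _ _ _ => le_rfl, Nat.zero_le _, fun _ _ => rfl⟩
  simp [boxGF, this]

theorem boxGF_zero_left (t : ℕ) : boxGF 0 t = 1 :=
  boxGF_eq_one_of_forall fun _ h => funext fun i =>
    Nat.le_zero.1 ((h.1 (Nat.zero_le i)).trans h.2.1)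

theorem boxGF_zero_right (c : ℕ) : boxGF c 0 = 1 :=
  boxGF_eq_one_of_forall fun _ h => funext fun i => h.2.2 i (Nat.zero_le i)

/-- The `q`-Pascal rule: either the largest part is at most `c`, or it equals `c + 1` and is
removed. -/
theorem boxGF_succ_succ (c t : ℕ) :
    boxGF (c + 1) (t + 1) = boxGF c (t + 1) + q ^ (c + 1) * boxGF (c + 1) t := by
  classical
  rw [boxGF, ← Finset.sum_filter_add_sum_filter_not _ (fun rho : ℕ → ℕ => rho 0 ≤ c)]
  congr 1
  · rw [boxGF]
    refine Finset.sum_congr ?_ fun _ _ => rfl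
    ext rho
    simp only [Finset.mem_filter, Set.Finite.mem_toFinset, box, Set.mem_ofPred_eq]
    constructor
    · rintro ⟨⟨h1, -, h3⟩, h4⟩; exact ⟨h1, h4, h3⟩
    · rintro ⟨h1, h2, h3⟩; exact ⟨⟨h1, by omega, h3⟩, h2⟩
  · rw [boxGF, Finset.mul_sum]
    refine Finset.sum_nbij' (fun rho i => rho (i + 1))
      (fun rho i => Nat.casesOn i (c + 1) rho) ?_ ?_ ?_ ?_ ?_
    · intro rho
      simp only [Finset.mem_filter, Set.Finite.mem_toFinset, box, Set.mem_ofPred_eq]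
      rintro ⟨⟨h1, h2, h3⟩, h4⟩
      exact ⟨fun i j hij => h1 (by omega), (h1 (Nat.zero_le _)).trans h2,
        fun i hi => h3 _ (by omega)⟩
    · intro rho
      simp only [Finset.mem_filter, Set.Finite.mem_toFinset, box, Set.mem_ofPred_eq]
      rintro ⟨h1, h2, h3⟩
      refine ⟨⟨antitone_nat_of_succ_le fun i => ?_, le_rfl, fun i hi => ?_⟩, Nat.not_succ_le_self c⟩
      · cases i with
        | zero => exact h2
        | succ i => exact h1 (Nat.le_succ i)
      · cases i with
        | zero => omega
        | succ i => exact h3 i (by omega)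
    · intro rho
      simp only [Finset.mem_filter, Set.Finite.mem_toFinset, box, Set.mem_ofPred_eq]
      rintro ⟨⟨h1, h2, h3⟩, h4⟩
      funext i
      cases i with
      | zero => change c + 1 = rho 0; omega
      | succ i => rfl
    · intro rho _; rfl
    · intro rho
      simp only [Finset.mem_filter, Set.Finite.mem_toFinset, box, Set.mem_ofPred_eq]
      rintro ⟨⟨h1, h2, h3⟩, h4⟩
      have : rho 0 = c + 1 := by omega
      rw [Finset.sum_range_succ', this, pow_add, mul_comm]

theorem boxGF_mul (c t : ℕ) : boxGF c t * (qPoch q c * qPoch q t) = qPoch q (c + t) := by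
  induction c generalizing t with
  | zero => simp [boxGF_zero_left, qPoch]
  | succ c ihc =>
    induction t with
    | zero => simp [boxGF_zero_right, qPoch]
    | succ t iht =>
      have h1 := ihc (t + 1)
      have e : c + 1 + t = c + t + 1 := by omega
      have e' : c + 1 + (t + 1) = c + t + 1 + 1 := by omega
      rw [← add_assoc] at h1
      rw [e] at iht
      rw [boxGF_succ_succ, e', qPoch_succ q (c + t + 1)]
      have hc := qPoch_succ q c
      have ht := qPoch_succ q t
      rw [← pow_succ'] at *
      have hp : q ^ (c + t + 1 + 1) = q ^ (c + 1) * q ^ (t + 1) := by ring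
      rw [hp]
      linear_combination boxGF c (t + 1) * qPoch q (t + 1) * hc +
        q ^ (c + 1) * boxGF (c + 1) t * qPoch q (c + 1) * ht +
        (1 - q ^ (c + 1)) * h1 + q ^ (c + 1) * (1 - q ^ (t + 1)) * iht

/-! ### The cutting recursion -/

theorem truncated_zero_eq {M : ℕ} {lam : ℕ → ℕ} (h : lam ∈ truncated 0 M) : lam = 0 := by
  funext i
  induction i with
  | zero => exact Nat.le_zero.1 h.2.1
  | succ i ih =>
    have := h.1 i
    rw [ih] at this
    simpa using this

theorem truncGF_zero (M : ℕ) : truncGF 0 M = 1 := by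
  have : (truncated_finite 0 M).toFinset = {0} := by
    ext lam
    simp only [Set.Finite.mem_toFinset, Finset.mem_singleton]
    refine ⟨truncated_zero_eq, ?_⟩
    rintro rfl
    exact ⟨by simp, Nat.zero_le _, fun _ _ => rfl⟩
  simp [truncGF, this]

/-- An increase would give `(lam i + 1)(i + 1) ≤ lam i (i + 2)`, that is, `i + 1 ≤ lam i`. Hence the
entries after the cut form a partition. -/
theorem succ_le_self_of_le {lam : ℕ → ℕ} (h : ∀ i, lam (i + 1) * (i + 1) ≤ lam i * (i + 2))
    {i : ℕ} (hi : lam i ≤ i) : lam (i + 1) ≤ lam i := by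
  by_contra hlt
  have h1 := h i
  have h2 : (lam i + 1) * (i + 1) ≤ lam (i + 1) * (i + 1) :=
    Nat.mul_le_mul_right _ (by omega)
  nlinarith

theorem le_of_le_index {lam : ℕ → ℕ} (h : ∀ i, lam (i + 1) * (i + 1) ≤ lam i * (i + 2))
    {m : ℕ} (hm : lam m ≤ m) (j : ℕ) : lam (m + j) ≤ m + j := by
  induction j with
  | zero => exact hm
  | succ j ih => exact (succ_le_self_of_le h ih).trans (ih.trans (Nat.le_succ _))

/-- Splitting an anti-lecture hall composition after its last entry `lam_i` with `lam_i ≥ i`. -/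
theorem truncGF_succ (b M : ℕ) :
    truncGF (b + 1) M =
      ∑ m ∈ Finset.range (M + 1), q ^ tri m * truncGF b m * boxGF m (M - m) := by
  classical
  have fib : ∀ lam : ℕ → ℕ, lam ∈ truncated (b + 1) M → ∃ m, lam m ≤ m :=
    fun lam h => ⟨M, by rw [h.2.2 M le_rfl]; exact Nat.zero_le _⟩
  -- With indices from 0, the first `m` with `lam m ≤ m` counts the leading entries exceeding their
  -- index. The default `0` is never reached on `truncated`, where `M` qualifies.
  let cut : (ℕ → ℕ) → ℕ := fun lam => if h : ∃ m, lam m ≤ m then Nat.find h else 0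
  have cut_eq : ∀ lam : ℕ → ℕ, lam ∈ truncated (b + 1) M → ∀ m,
      cut lam = m ↔ lam m ≤ m ∧ ∀ i < m, i < lam i := by
    intro lam h m
    simp only [cut, dif_pos (fib lam h), Nat.find_eq_iff, not_le]
  have maps : ∀ lam ∈ (truncated_finite (b + 1) M).toFinset, cut lam ∈ Finset.range (M + 1) := by
    intro lam h
    rw [Set.Finite.mem_toFinset] at h
    have h1 := ((cut_eq lam h _).1 rfl).2 M
    rw [h.2.2 M le_rfl] at h1
    rw [Finset.mem_range]
    omega
  rw [truncGF, ← Finset.sum_fiberwise_of_maps_to maps]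
  refine Finset.sum_congr rfl fun m hm => ?_
  have hmM : m ≤ M := Nat.lt_succ_iff.1 (Finset.mem_range.1 hm)
  rw [truncGF, boxGF, mul_assoc, Finset.sum_mul_sum, ← Finset.sum_product', Finset.mul_sum]
  refine Finset.sum_nbij'
    (fun lam => (fun i => if i < m then lam i - (i + 1) else 0, fun i => lam (m + i)))
    (fun x i => if i < m then x.1 i + (i + 1) else x.2 (i - m)) ?_ ?_ ?_ ?_ ?_
  · intro lam hl
    simp only [Finset.mem_filter, Set.Finite.mem_toFinset] at hl
    obtain ⟨hl, hc⟩ := hl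
    obtain ⟨hc1, hc2⟩ := (cut_eq lam hl m).1 hc
    simp only [Finset.mem_product, Set.Finite.mem_toFinset]
    refine ⟨⟨fun i => ?_, ?_, fun i hi => if_neg (by omega)⟩,
      antitone_nat_of_succ_le fun i => ?_, hc1, fun i hi => hl.2.2 _ (by omega)⟩
    -- Subtracting `i + 1` from entry `i` removes `(i + 1)(i + 2)` from both sides of the
    -- inequality.
    · beta_reduce
      by_cases hi : i + 1 < m
      · have h1 := hc2 i (by omega)
        have h2 := hc2 (i + 1) hi
        have h3 := hl.1 i
        rw [if_pos hi, if_pos (by omega)]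
        obtain ⟨x, hx⟩ := Nat.exists_eq_add_of_lt h1
        obtain ⟨y, hy⟩ := Nat.exists_eq_add_of_lt h2
        have hx' : lam i - (i + 1) = x := by omega
        have hy' : lam (i + 1) - (i + 1 + 1) = y := by omega
        rw [hx', hy']
        rw [hx, hy] at h3
        nlinarith
      · rw [if_neg hi]; simp
    · have := hl.2.1
      beta_reduce
      split_ifs <;> omega
    · exact succ_le_self_of_le hl.1 (le_of_le_index hl.1 hc1 i)
  · rintro ⟨mu, rho⟩ hx
    simp only [Finset.mem_product, Set.Finite.mem_toFinset] at hx
    obtain ⟨⟨h1, h2, h3⟩, h4, h5, h6⟩ := hx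
    have hmem : (fun i => if i < m then mu i + (i + 1) else rho (i - m)) ∈
        truncated (b + 1) M := by
      refine ⟨fun i => ?_, ?_, fun i hi => ?_⟩
      · rcases lt_trichotomy (i + 1) m with hi | hi | hi
        · have := h1 i
          simp only [if_pos hi, if_pos (show i < m by omega)]
          nlinarith
        -- At the cut, `rho 0 ≤ m` while the entry before it is at least `m`.
        · subst hi
          simp only [lt_irrefl, if_false, if_pos (Nat.lt_succ_self i), Nat.sub_self]
          have : rho 0 * (i + 1) ≤ (i + 1) * (i + 2) := Nat.mul_le_mul (by omega) (by omega)
          nlinarith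
        · simp only [if_neg (show ¬ i + 1 < m by omega), if_neg (show ¬ i < m by omega)]
          exact Nat.mul_le_mul (h4 (by omega)) (by omega)
      · simp only
        split_ifs with h
        · omega
        · have : rho (0 - m) ≤ rho 0 := h4 (Nat.zero_le _)
          omega
      · simp only [if_neg (show ¬ i < m by omega)]
        exact h6 _ (by omega)
    simp only [Finset.mem_filter, Set.Finite.mem_toFinset]
    refine ⟨hmem, (cut_eq _ hmem m).2 ⟨?_, fun i hi => ?_⟩⟩
    · simpa using h5
    · simp only [if_pos hi]; omega
  · intro lam hl
    simp only [Finset.mem_filter, Set.Finite.mem_toFinset] at hl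
    obtain ⟨hl, hc⟩ := hl
    obtain ⟨hc1, hc2⟩ := (cut_eq lam hl m).1 hc
    funext i
    by_cases hi : i < m
    · have := hc2 i hi
      simp only [if_pos hi]; omega
    · simp only [if_neg hi]
      congr 1; omega
  · rintro ⟨mu, rho⟩ hx
    simp only [Finset.mem_product, Set.Finite.mem_toFinset] at hx
    obtain ⟨⟨h1, h2, h3⟩, h4, h5, h6⟩ := hx
    refine Prod.ext (funext fun i => ?_) (funext fun i => ?_)
    · by_cases hi : i < m
      · simp [hi]
      · simp [hi, h3 i (by omega)]
    · simp
  · intro lam hl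
    simp only [Finset.mem_filter, Set.Finite.mem_toFinset] at hl
    obtain ⟨hl, hc⟩ := hl
    obtain ⟨hc1, hc2⟩ := (cut_eq lam hl m).1 hc
    rw [← pow_add, ← pow_add]
    congr 1
    have hM : M = m + (M - m) := by omega
    conv_lhs => rw [hM, Finset.sum_range_add]
    rw [← add_assoc, ← sum_range_succ_eq_tri, ← Finset.sum_add_distrib]
    congr 1
    refine Finset.sum_congr rfl fun i hi => ?_
    have hi := Finset.mem_range.1 hi
    have := hc2 i hi
    simp only [if_pos hi]; omega

/-! ### The normalised chain -/

/-- `truncGF b M / (q; q)_M`. -/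
noncomputable def normGF (b M : ℕ) : PowerSeries ℤ := qInv M * truncGF b M

theorem normGF_zero (M : ℕ) : normGF 0 M = qInv M := by simp [normGF, truncGF_zero]

theorem normGF_succ (b M : ℕ) :
    normGF (b + 1) M =
      ∑ m ∈ Finset.range (M + 1), q ^ tri m * qInv (M - m) * normGF b m := by
  rw [normGF, truncGF_succ, Finset.mul_sum]
  refine Finset.sum_congr rfl fun m hm => ?_
  have hM : m + (M - m) = M := by have := Finset.mem_range.1 hm; omega
  have h := boxGF_mul m (M - m)
  rw [hM] at h
  have h1 := qPoch_mul_qInv M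
  have h2 := qPoch_mul_qInv m
  have h3 := qPoch_mul_qInv (M - m)
  have key : qInv M * boxGF m (M - m) = qInv (M - m) * qInv m := by
    calc qInv M * boxGF m (M - m)
        = qInv M * boxGF m (M - m) * (qPoch q m * qInv m) *
            (qPoch q (M - m) * qInv (M - m)) := by rw [h2, h3]; ring
      _ = boxGF m (M - m) * (qPoch q m * qPoch q (M - m)) * qInv M *
            (qInv (M - m) * qInv m) := by ring
      _ = qInv (M - m) * qInv m := by rw [h, h1, one_mul]
  rw [normGF]
  linear_combination q ^ tri m * truncGF b m * key

/-- The inner multisum: `normGF (2 j) M / (-q; q)_M`. -/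
noncomputable def innerGF (j M : ℕ) : PowerSeries ℤ := negInv M * normGF (2 * j) M

theorem innerGF_zero (M : ℕ) : innerGF 0 M = negInv M * qInv M := by
  simp [innerGF, normGF_zero]

theorem innerGF_succ (j M : ℕ) :
    innerGF (j + 1) M =
      ∑ r ∈ Finset.range (M + 1), q ^ (r ^ 2 + r) * qInv (M - r) * innerGF j r :=
  two_step (normGF (2 * j)) (normGF (2 * j + 1)) (normGF (2 * j + 2))
    (normGF_succ _) (normGF_succ _) M

/-! ### Letting the length tend to infinity -/

theorem coeff_q_pow_mul_qPoch (e s t : ℕ) (n : ℕ) (h : n ≤ e + t) :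
    PowerSeries.coeff n (q ^ e * ∏ j ∈ Finset.range s, (1 - q * q ^ (t + j))) =
      PowerSeries.coeff n (q ^ e) := by
  have hd : q ^ (t + 1) ∣ ∏ j ∈ Finset.range s, (1 - q * q ^ (t + j)) - 1 := by
    induction s with
    | zero => simp
    | succ s ih =>
      rw [Finset.prod_range_succ]
      have : q ^ (t + 1) ∣ q * q ^ (t + s) := ⟨q ^ s, by ring⟩
      have h2 := dvd_sub ih (this.mul_left (∏ j ∈ Finset.range s, (1 - q * q ^ (t + j))))
      convert h2 using 1
      ring
  obtain ⟨c, hc⟩ := hd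
  rw [sub_eq_iff_eq_add.1 hc, mul_add, mul_one, map_add, ← mul_assoc, ← pow_add]
  have : PowerSeries.coeff n (q ^ (e + (t + 1)) * c) = 0 :=
    PowerSeries.X_pow_dvd_iff.1 (Dvd.intro _ rfl) n (by omega)
  rw [this, zero_add]

theorem coeff_mul_eq_of_le {f g : PowerSeries ℤ} (n : ℕ)
    (h : ∀ i ≤ n, PowerSeries.coeff i f = PowerSeries.coeff i g) (c : PowerSeries ℤ) :
    PowerSeries.coeff n (f * c) = PowerSeries.coeff n (g * c) := by
  rw [PowerSeries.coeff_mul, PowerSeries.coeff_mul]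
  refine Finset.sum_congr rfl fun p hp => ?_
  rw [h p.1 (by have := Finset.HasAntidiagonal.mem_antidiagonal.1 hp; omega)]

/-- The limit `M → ∞` is already reached at `M = n`: `(q;q)_n / (q;q)_(n-m)` is `1` modulo
`q^(n-m+1)`, and the factor `q ^ tri m` with `tri m ≥ m` pushes the error beyond degree `n`. -/
theorem coeff_truncGF_succ (b n : ℕ) :
    PowerSeries.coeff n (truncGF (b + 1) n) =
      ∑ m ∈ Finset.range (n + 1), PowerSeries.coeff n (q ^ tri m * normGF b m) := by
  have h : truncGF (b + 1) n = qPoch q n * normGF (b + 1) n := by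
    rw [normGF, ← mul_assoc, qPoch_mul_qInv, one_mul]
  rw [h, normGF_succ, Finset.mul_sum, map_sum]
  refine Finset.sum_congr rfl fun m hm => ?_
  have hM : n - m + m = n := by have := Finset.mem_range.1 hm; omega
  have hp : qPoch q n = qPoch q (n - m) * ∏ j ∈ Finset.range m, (1 - q * q ^ (n - m + j)) := by
    conv_lhs => rw [← hM, qPoch, Finset.prod_range_add]
    rfl
  have e : qPoch q n * (q ^ tri m * qInv (n - m) * normGF b m) =
      (q ^ tri m * ∏ j ∈ Finset.range m, (1 - q * q ^ (n - m + j))) * normGF b m := by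
    rw [hp]
    linear_combination q ^ tri m * normGF b m *
      (∏ j ∈ Finset.range m, (1 - q * q ^ (n - m + j))) * qPoch_mul_qInv (n - m)
  rw [e]
  refine coeff_mul_eq_of_le n (fun i hi => coeff_q_pow_mul_qPoch _ _ _ _ ?_) _
  have := le_tri m
  omega

/-! ### From `F b n` to compositions of length at most `n` -/

theorem isAntiLectureHall_iff (lam : ℕ →₀ ℕ) :
    IsAntiLectureHall lam ↔ ∀ i, lam (i + 1) * (i + 1) ≤ lam i * (i + 2) := by
  refine forall_congr' fun i => ?_
  rw [div_le_div_iff₀ (by positivity) (by positivity)]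
  norm_cast

/-- A zero entry forces the next to vanish, so a nonzero entry at index `i ≥ n` would give at least
`n + 1` positive entries. -/
theorem apply_eq_zero_of_sum_eq {lam : ℕ →₀ ℕ} (h : IsAntiLectureHall lam) {n : ℕ}
    (hn : (lam.sum fun _ a => a) = n) {i : ℕ} (hi : n ≤ i) : lam i = 0 := by
  rw [isAntiLectureHall_iff] at h
  by_contra hne
  have hpos : ∀ j ≤ i, lam j ≠ 0 := fun j hj => by
    refine Nat.decreasingInduction' (P := fun j => lam j ≠ 0) (fun k _ _ hk h0 => ?_) hj hne
    have := h k
    rw [h0, zero_mul, Nat.le_zero, mul_eq_zero] at this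
    omega
  have hsub : Finset.range (i + 1) ⊆ lam.support := fun j hj =>
    Finsupp.mem_support_iff.2 (hpos j (Nat.lt_succ_iff.1 (Finset.mem_range.1 hj)))
  have h1 : ∑ j ∈ lam.support, 1 ≤ ∑ j ∈ lam.support, lam j :=
    Finset.sum_le_sum fun j hj => Nat.one_le_iff_ne_zero.2 (Finsupp.mem_support_iff.1 hj)
  have h2 := Finset.card_le_card hsub
  rw [Finset.sum_const, smul_eq_mul, mul_one] at h1
  rw [Finset.card_range] at h2
  rw [Finsupp.sum] at hn
  omega

theorem sum_eq_sum_range {lam : ℕ →₀ ℕ} {n : ℕ} (h : ∀ i, n ≤ i → lam i = 0) :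
    (lam.sum fun _ a => a) = ∑ i ∈ Finset.range n, lam i := by
  refine Finsupp.sum_of_support_subset _ (fun i hi => ?_) _ fun _ _ => rfl
  by_contra hni
  exact Finsupp.mem_support_iff.1 hi (h i (by simpa using hni))

theorem image_F (b n : ℕ) :
    (fun lam : ℕ →₀ ℕ => (lam : ℕ → ℕ)) '' F b n =
      {lam | lam ∈ truncated b n ∧ ∑ i ∈ Finset.range n, lam i = n} := by
  ext f
  constructor
  · rintro ⟨lam, ⟨h1, h2, h3⟩, rfl⟩
    have hz : ∀ i, n ≤ i → lam i = 0 := fun i hi => apply_eq_zero_of_sum_eq h1 h2 hi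
    exact ⟨⟨(isAntiLectureHall_iff _).1 h1, h3, hz⟩, (sum_eq_sum_range hz).symm.trans h2⟩
  · rintro ⟨⟨h1, h2, h3⟩, h4⟩
    refine ⟨Finsupp.onFinset (Finset.range n) f fun i hi => ?_, ⟨?_, ?_, h2⟩, rfl⟩
    · by_contra hni
      exact hi (h3 i (by simpa using hni))
    · exact (isAntiLectureHall_iff _).2 h1
    · exact (sum_eq_sum_range h3).trans h4

theorem F_finite (b n : ℕ) : (F b n).Finite := by
  refine Set.Finite.of_finite_image (f := fun lam : ℕ →₀ ℕ => (lam : ℕ → ℕ)) ?_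
    DFunLike.coe_injective.injOn
  rw [image_F]
  exact (truncated_finite b n).subset fun _ h => h.1

theorem ncard_F (b n : ℕ) :
    ((F b n).ncard : ℤ) = PowerSeries.coeff n (truncGF b n) := by
  classical
  have h : {lam : ℕ → ℕ | lam ∈ truncated b n ∧ ∑ i ∈ Finset.range n, lam i = n} =
      ((truncated_finite b n).toFinset.filter
        fun lam => n = ∑ i ∈ Finset.range n, lam i : Finset (ℕ → ℕ)) := by
    ext lam; simp [eq_comm]
  rw [← Set.ncard_image_of_injective (F b n) DFunLike.coe_injective, image_F, h,
    Set.ncard_coe_finset, truncGF, map_sum]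
  simp only [q, PowerSeries.coeff_X_pow]
  rw [Finset.sum_boole]

/-! ### The multisum as an iterated sum -/

theorem entry_one {m : ℕ} (N : Fin (m + 1) → ℕ) : entry N 1 = N 0 := by
  simp [entry]

theorem entry_cons {m : ℕ} (r : ℕ) (N : Fin m → ℕ) (i : ℕ) :
    entry (Fin.cons r N : Fin (m + 1) → ℕ) (i + 1 + 1) = entry N (i + 1) := by
  unfold entry
  by_cases h : i + 1 ≤ m
  · rw [dif_pos ⟨by omega, by omega⟩, dif_pos ⟨by omega, h⟩]
    exact Fin.cons_succ (α := fun _ => ℕ) r N ⟨i, by omega⟩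
  · rw [dif_neg (by omega), dif_neg (by omega)]

/-- The part of the summand that does not involve `N_1` except through `(q; q)_(N_1 - N_2)`. -/
noncomputable def tailTerm (m : ℕ) (N : Fin (m + 1) → ℕ) : PowerSeries ℤ :=
  q ^ (∑ i ∈ Finset.range m, (entry N (i + 2) ^ 2 + entry N (i + 2))) *
    (∏ i ∈ Finset.range m, qInv (entry N (i + 1) - entry N (i + 2))) *
    (qInv (entry N (m + 1)) * negInv (entry N (m + 1)))

theorem invOfUnit_denom (m : ℕ) (N : Fin (m + 1) → ℕ) :
    PowerSeries.invOfUnit (denom (m + 2) N) 1 =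
      (∏ i ∈ Finset.range m, qInv (entry N (i + 1) - entry N (i + 2))) *
        (qInv (entry N (m + 1)) * negInv (entry N (m + 1))) := by
  refine (left_inv_eq_right_inv ?_ (denom_mul_inv (m + 2) N)).symm
  have hIcc : ∏ i ∈ Finset.Icc 1 m, qPoch q (entry N i - entry N (i + 1)) =
      ∏ i ∈ Finset.range m, qPoch q (entry N (i + 1) - entry N (i + 2)) := by
    rw [Finset.range_eq_Ico, Finset.prod_Ico_add' (fun i => qPoch q (entry N i - entry N (i + 1)))]
    rfl
  have hprod : (∏ i ∈ Finset.range m, qPoch q (entry N (i + 1) - entry N (i + 2))) *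
      ∏ i ∈ Finset.range m, qInv (entry N (i + 1) - entry N (i + 2)) = 1 := by
    rw [← Finset.prod_mul_distrib]
    exact Finset.prod_eq_one fun i _ => qPoch_mul_qInv _
  have hd : denom (m + 2) N =
      (∏ i ∈ Finset.range m, qPoch q (entry N (i + 1) - entry N (i + 2))) *
        qPoch q (entry N (m + 1)) * qPoch (-q) (entry N (m + 1)) := by
    rw [← hIcc]; rfl
  rw [hd]
  have h2 := qPoch_mul_qInv (entry N (m + 1))
  have h3 := qPoch_mul_negInv (entry N (m + 1))
  generalize (∏ i ∈ Finset.range m, qPoch q (entry N (i + 1) - entry N (i + 2))) = P at *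
  generalize (∏ i ∈ Finset.range m, qInv (entry N (i + 1) - entry N (i + 2))) = Q at *
  calc _ = P * Q * (qPoch q (entry N (m + 1)) * qInv (entry N (m + 1))) *
        (qPoch (-q) (entry N (m + 1)) * negInv (entry N (m + 1))) := by ring
    _ = 1 := by rw [hprod, h2, h3]; ring

theorem summand_eq (m : ℕ) (N : Fin (m + 1) → ℕ) :
    summand (m + 2) N = q ^ tri (N 0) * qPoch (-q) (N 0) * tailTerm m N := by
  have he : expo (m + 2) N =
      tri (N 0) + ∑ i ∈ Finset.range m, (entry N (i + 2) ^ 2 + entry N (i + 2)) := by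
    have h : ∑ i ∈ Finset.Icc 2 (m + 1), (entry N i ^ 2 + entry N i) =
        ∑ i ∈ Finset.range m, (entry N (i + 2) ^ 2 + entry N (i + 2)) := by
      rw [Finset.range_eq_Ico, Finset.sum_Ico_add' (fun i => entry N i ^ 2 + entry N i)]
      exact Finset.sum_congr (by ext; simp; omega) fun _ _ => rfl
    rw [← h, Finset.sum_add_distrib, ← add_assoc, ← entry_one N]
    rfl
  rw [summand, he, invOfUnit_denom, tailTerm, pow_add, ← entry_one N]
  ring

theorem tailTerm_zero (N : Fin 1 → ℕ) : tailTerm 0 N = negInv (N 0) * qInv (N 0) := by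
  simp [tailTerm, entry_one, mul_comm]

theorem tailTerm_cons (m r : ℕ) (N : Fin (m + 1) → ℕ) :
    tailTerm (m + 1) (Fin.cons r N : Fin (m + 2) → ℕ) =
      q ^ (N 0 ^ 2 + N 0) * qInv (r - N 0) * tailTerm m N := by
  have h1 : entry (Fin.cons r N : Fin (m + 2) → ℕ) 1 = r := entry_one _
  have h2 := entry_one N
  rw [tailTerm, tailTerm, Finset.sum_range_succ', Finset.prod_range_succ', pow_add]
  simp only [entry_cons, zero_add, h1, h2, entry_cons r N 0]
  ring

/-- Antitone tuples with prescribed first entry. -/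
def tuples (m r : ℕ) : Set (Fin (m + 1) → ℕ) := {N | Antitone N ∧ N 0 = r}

theorem tuples_finite (m r : ℕ) : (tuples m r).Finite :=
  (Set.finite_Iic fun _ : Fin (m + 1) => r).subset fun _ h i =>
    (h.1 (Fin.zero_le i)).trans h.2.le

theorem antitone_cons {m : ℕ} (r : ℕ) (N : Fin (m + 1) → ℕ) :
    Antitone (Fin.cons r N : Fin (m + 2) → ℕ) ↔ N 0 ≤ r ∧ Antitone N := by
  rw [Fin.antitone_iff_succ_le, Fin.forall_fin_succ, Fin.antitone_iff_succ_le]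
  rfl

/-- Peeling off the first entry of the tuple matches the recursion `innerGF_succ`, by
`tailTerm_cons`. -/
theorem sum_tailTerm (m r : ℕ) :
    ∑ N ∈ (tuples_finite m r).toFinset, tailTerm m N = innerGF m r := by
  induction m generalizing r with
  | zero =>
    have : (tuples_finite 0 r).toFinset = {fun _ => r} := by
      ext N
      simp only [Set.Finite.mem_toFinset, tuples, Set.mem_ofPred_eq, Finset.mem_singleton]
      constructor
      · rintro ⟨-, h⟩
        funext i
        rw [Fin.fin_one_eq_zero i, h]
      · rintro rfl
        exact ⟨antitone_const, rfl⟩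
    rw [this, Finset.sum_singleton, tailTerm_zero, innerGF_zero]
  | succ m ih =>
    simp only [innerGF_succ, ← ih, Finset.mul_sum, Finset.sum_sigma']
    refine Finset.sum_nbij' (fun N => ⟨N 1, Fin.tail N⟩)
      (fun x => (Fin.cons r x.2 : Fin (m + 2) → ℕ)) ?_ ?_ ?_ ?_ ?_
    · intro N hN
      simp only [Set.Finite.mem_toFinset, tuples, Set.mem_ofPred_eq] at hN
      rw [← Fin.cons_self_tail N, antitone_cons, Fin.cons_zero] at hN
      obtain ⟨⟨h1, h2⟩, h3⟩ := hN
      simp only [Finset.mem_sigma, Finset.mem_range, Set.Finite.mem_toFinset, tuples,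
        Set.mem_ofPred_eq]
      exact ⟨by rw [← h3]; exact Nat.lt_succ_of_le h1, h2, rfl⟩
    · rintro ⟨s, N⟩ h
      simp only [Finset.mem_sigma, Finset.mem_range, Set.Finite.mem_toFinset, tuples,
        Set.mem_ofPred_eq] at h
      obtain ⟨h1, h2, h3⟩ := h
      simp only [Set.Finite.mem_toFinset, tuples, Set.mem_ofPred_eq]
      exact ⟨(antitone_cons r N).2 ⟨by omega, h2⟩, rfl⟩
    · intro N hN
      simp only [Set.Finite.mem_toFinset, tuples, Set.mem_ofPred_eq] at hN
      simp only [← hN.2, Fin.cons_self_tail]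
    · rintro ⟨s, N⟩ h
      simp only [Finset.mem_sigma, Finset.mem_range, Set.Finite.mem_toFinset, tuples,
        Set.mem_ofPred_eq] at h
      obtain ⟨h1, h2, rfl⟩ := h
      rfl
    · intro N hN
      simp only [Set.Finite.mem_toFinset, tuples, Set.mem_ofPred_eq] at hN
      conv_lhs => rw [← Fin.cons_self_tail N, tailTerm_cons, hN.2]
      rfl

theorem sum_summand (m r : ℕ) :
    ∑ N ∈ (tuples_finite m r).toFinset, summand (m + 2) N = q ^ tri r * normGF (2 * m) r := by
  have h : ∀ N ∈ (tuples_finite m r).toFinset,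
      summand (m + 2) N = q ^ tri r * qPoch (-q) r * tailTerm m N := by
    intro N hN
    rw [Set.Finite.mem_toFinset] at hN
    rw [summand_eq, hN.2]
  rw [Finset.sum_congr rfl h, ← Finset.mul_sum, sum_tailTerm, innerGF]
  linear_combination q ^ tri r * normGF (2 * m) r * qPoch_mul_negInv r

/-! ### Coefficientwise convergence -/

theorem coeff_summand_eq_zero {m n : ℕ} {N : Fin (m + 1) → ℕ} (h : n < N 0) :
    PowerSeries.coeff n (summand (m + 2) N) = 0 := by
  rw [summand_eq, mul_assoc]
  exact PowerSeries.X_pow_dvd_iff.1 (Dvd.intro _ rfl) n (h.trans_le (le_tri _))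

theorem hasSum_summand (m : ℕ) :
    HasSum (fun N : {N : Fin (m + 1) → ℕ // Antitone N} => summand (m + 2) N.1)
      (PowerSeries.mk fun n => ((F (2 * m + 1) n).ncard : ℤ)) := by
  classical
  rw [PowerSeries.WithPiTopology.hasSum_iff_hasSum_coeff]
  intro n
  rw [PowerSeries.coeff_mk, ncard_F, coeff_truncGF_succ]
  have hfin : ∀ r, ∑ N ∈ (tuples_finite m r).toFinset, PowerSeries.coeff n (summand (m + 2) N) =
      PowerSeries.coeff n (q ^ tri r * normGF (2 * m) r) := fun r => by
    rw [← sum_summand, map_sum]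
  simp only [← hfin]
  rw [← Finset.sum_biUnion fun r _ s _ hrs => Finset.disjoint_left.2 fun N hr hs => hrs (by
    rw [Set.Finite.mem_toFinset] at hr hs
    rw [← hr.2, hs.2])]
  set S := (Finset.range (n + 1)).biUnion fun r => (tuples_finite m r).toFinset
  have hS : ∀ N ∈ S, Antitone N := by
    intro N hN
    obtain ⟨r, -, hr⟩ := Finset.mem_biUnion.1 hN
    exact ((Set.Finite.mem_toFinset _).1 hr).1
  rw [← Finset.sum_subtype_of_mem
    (fun N : Fin (m + 1) → ℕ => PowerSeries.coeff n (summand (m + 2) N)) hS]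
  -- `S` holds all antitone tuples with `N_1 ≤ n`; any other summand is divisible by `q ^ tri N_1`
  -- with `tri N_1 > n`.
  refine hasSum_sum_of_ne_finset_zero fun N hN => coeff_summand_eq_zero ?_
  by_contra hlt
  refine hN (Finset.mem_subtype.2 (Finset.mem_biUnion.2 ⟨N.1 0, ?_, ?_⟩))
  · exact Finset.mem_range.2 (by omega)
  · exact (Set.Finite.mem_toFinset _).2 ⟨N.2, rfl⟩

end AntiLectureHall

theorem theorem4p2 (k : ℕ) (hk : 2 ≤ k) :
    (∀ n : ℕ, (AntiLectureHall.F (2 * k - 3) n).Finite) ∧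
    HasSum
      (fun N : {N : Fin (k - 1) → ℕ // Antitone N} => AntiLectureHall.summand k N.1)
      (PowerSeries.mk fun n : ℕ => ((AntiLectureHall.F (2 * k - 3) n).ncard : ℤ)) := by
  refine ⟨fun n => AntiLectureHall.F_finite _ n, ?_⟩
  obtain ⟨m, rfl⟩ := Nat.exists_eq_add_of_le' hk
  have h : 2 * (m + 2) - 3 = 2 * m + 1 := by omega
  rw [h]
  exact AntiLectureHall.hasSum_summand m
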